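/- Let $R$ be a commutative ring in which $2$ is invertible, let $I$ be an ideal of $R$, and let $n \ge 2$. For $m \ge 1$ let $\mathrm{Um}_m(R,I)$ be the set of rows $v \in R^m$ that are unimodular (i.e. $\sum_i v_i w_i = 1$ for some $w \in R^m$) and congruent to $e_1 = (1,0,\dots,0)$ modulo $I$. For an ideal $J$ of $R$ let $\mathrm{E}_m(J) \subseteq \mathrm{SL}_m(R)$ be the subgroup generated by the matrices $1 + x e_{ij}$ with $x \in J$, $i \ne j$; put $\mathrm{E}_m(R)$ for the case $J = R$, and let $\mathrm{E}_m(R,I)$ be the normal closure of $\mathrm{E}_m(I)$ in $\mathrm{E}_m(R)$. Let $\sigma$ be the permutation of $\{1,\dots,2n\}$ with $\sigma(2i) = 2i-1$ and $\sigma(2i-1) = 2i$, and for $i \ne j$ and $z \in R$ let $se_{ij}(z) = 1 + z e_{ij}$ if $i = \sigma(j)$ and $se_{ij}(z) = 1 + z e_{ij} - (-1)^{i+j} z e_{\sigma(j)\sigma(i)}$ if $i \ne \sigma(j)$. Let $\mathrm{ESp}_{2n}(J)$ be the group generated by the $se_{ij}(x)$ with $x \in J$, $i \ne j$; put $\mathrm{ESp}_{2n}(R)$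 for the case $J = R$, and let $\mathrm{ESp}_{2n}(R,I)$ be the normal closure of $\mathrm{ESp}_{2n}(I)$ in $\mathrm{ESp}_{2n}(R)$. The groups $\mathrm{ESp}_{2n}(R,I) \subseteq \mathrm{E}_{2n}(R,I)$ act on $\mathrm{Um}_{2n}(R,I)$ by right multiplication. Then the natural map of orbit sets, sending the orbit of a row to its orbit under the larger group, $$\mathrm{Um}_{2n}(R,I)/\mathrm{ESp}_{2n}(R,I) \longrightarrow \mathrm{Um}_{2n}(R,I)/\mathrm{E}_{2n}(R,I)$$ is bijective. -/

import Mathlib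

namespace ElemOrbits

open Matrix

/-- The first standard basis row `e₁ = (1, 0, …, 0)` of length `m`. -/
def firstRow (m : ℕ) (R : Type*) [CommRing R] : Fin m → R :=
  fun i => if i.val = 0 then 1 else 0

/-- `Um_m(R, I)`: the unimodular rows of length `m` over `R` that are congruent to
`e₁` modulo `I`. -/
def Um (m : ℕ) {R : Type*} [CommRing R] (I : Ideal R) : Set (Fin m → R) :=
  {v | (∃ w : Fin m → R, ∑ i, v i * w i = 1) ∧ ∀ i, v i - firstRow m R i ∈ I}

/-- `E_m(I)`: the subgroup of `SL_m(R)` generated by the `E_ij(x) = 1 + x e_ij` with `x ∈ I`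
and `i ≠ j`. -/
def EGen (m : ℕ) {R : Type*} [CommRing R] (I : Ideal R) :
    Subgroup (SpecialLinearGroup (Fin m) R) :=
  Subgroup.closure {g | ∃ (i j : Fin m) (hij : i ≠ j), ∃ x ∈ I,
    g = SpecialLinearGroup.transvection hij x}

/-- The elementary group `E_m(R)`. -/
def EAbs (m : ℕ) (R : Type*) [CommRing R] : Subgroup (SpecialLinearGroup (Fin m) R) :=
  EGen m (⊤ : Ideal R)

/-- For subgroups `H`, `K` of a group, the normal closure of `H ∩ K` in the group `K`, seen as a
subgroup of the ambient group. It is used for `H ≤ K` only. -/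
def normalClosureIn {G : Type*} [Group G] (H K : Subgroup G) : Subgroup G :=
  (Subgroup.normalClosure ((H.subgroupOf K : Subgroup K) : Set K)).map K.subtype

/-- The relative elementary group `E_m(R, I)`: the normal closure of `E_m(I)` in `E_m(R)`. -/
def ERel (m : ℕ) {R : Type*} [CommRing R] (I : Ideal R) :
    Subgroup (SpecialLinearGroup (Fin m) R) :=
  normalClosureIn (EGen m I) (EAbs m R)

/-- The involution of the index set exchanging the members of the consecutive pairs
`{1, 2}, {3, 4}, …, {2n - 1, 2n}`. As `Fin (2 * n)` counts from `0`, the pairs are here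
`{0, 1}, {2, 3}, …`. -/
def sig {n : ℕ} (i : Fin (2 * n)) : Fin (2 * n) :=
  if h : i.val % 2 = 0 then ⟨i.val + 1, by omega⟩ else ⟨i.val - 1, by omega⟩

/-- The matrix `se_ij(z)`. It is written for all `i ≠ j`: if `i ≠ σ(j)` then
`se_ij(z) = se_{σ(j) σ(i)}(-(-1)^(i+j) z)`, and one of `i < j`, `σ(j) < σ(i)` holds, so one gets
the same matrices as from the pairs with `i = σ(j)` or `i < j`. Counting indices from `0` rather
than from `1` does not change the parity of `i + j`. -/
def seMat {n : ℕ} {R : Type*} [CommRing R] (i j : Fin (2 * n)) (z : R) :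
    Matrix (Fin (2 * n)) (Fin (2 * n)) R :=
  if i = sig j then 1 + single i j z
  else 1 + single i j z - single (sig j) (sig i) ((-1) ^ (i.val + j.val) * z)

theorem sig_ne {n : ℕ} (i : Fin (2 * n)) : sig i ≠ i := by
  intro h
  have h1 := congrArg Fin.val h
  unfold sig at h1
  split_ifs at h1 with h2
  · simp at h1
  · simp only at h1
    omega

theorem sig_sig {n : ℕ} (i : Fin (2 * n)) : sig (sig i) = i := by
  apply Fin.ext
  by_cases h : i.val % 2 = 0
  · have h1 : sig i = ⟨i.val + 1, by omega⟩ := dif_pos h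
    have h2 : ¬ (i.val + 1) % 2 = 0 := by omega
    rw [h1, sig, dif_neg h2]
    simp
  · have h1 : sig i = ⟨i.val - 1, by omega⟩ := dif_neg h
    have h2 : (i.val - 1) % 2 = 0 := by omega
    rw [h1, sig, dif_pos h2]
    simp only
    omega

theorem sig_injective {n : ℕ} : Function.Injective (sig : Fin (2 * n) → Fin (2 * n)) :=
  fun i j h => by rw [← sig_sig i, h, sig_sig]

theorem seMat_of_ne {n : ℕ} {R : Type*} [CommRing R] (i j : Fin (2 * n)) (h : i ≠ sig j) (z : R) :
    seMat i j z = (1 + single i j z) *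
      (1 + single (sig j) (sig i) (-((-1) ^ (i.val + j.val) * z))) := by
  have h0 : single i j z * single (sig j) (sig i) (-((-1) ^ (i.val + j.val) * z)) = 0 :=
    single_mul_single_of_ne _ _ _ _ (sig_ne j).symm _
  rw [seMat, if_neg h, add_mul, mul_add, mul_add, h0, ← single_neg]
  simp only [one_mul, mul_one, add_zero]
  abel

theorem det_seMat {n : ℕ} {R : Type*} [CommRing R] (i j : Fin (2 * n)) (hij : i ≠ j) (z : R) :
    (seMat i j z).det = 1 := by
  by_cases h : i = sig j
  · rw [seMat, if_pos h]
    exact det_transvection_of_ne i j hij z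
  · rw [seMat_of_ne i j h, det_mul]
    have h1 := det_transvection_of_ne i j hij z
    have h2 := det_transvection_of_ne (sig j) (sig i) (fun e => hij (sig_injective e).symm)
      (-((-1) ^ (i.val + j.val) * z))
    rw [transvection] at h1 h2
    rw [h1, h2, one_mul]

/-- The elementary symplectic generator `se_ij(z)`, for `i ≠ j`, as an element of `SL_{2n}(R)`. -/
def spGen {n : ℕ} {R : Type*} [CommRing R] (i j : Fin (2 * n)) (hij : i ≠ j) (z : R) :
    SpecialLinearGroup (Fin (2 * n)) R :=
  ⟨seMat i j z, det_seMat i j hij z⟩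

/-- `ESp_{2n}(I)`: the subgroup generated by the `se_ij(x)` with `x ∈ I` and `i ≠ j`. -/
def ESpGen (n : ℕ) {R : Type*} [CommRing R] (I : Ideal R) :
    Subgroup (SpecialLinearGroup (Fin (2 * n)) R) :=
  Subgroup.closure {g | ∃ (i j : Fin (2 * n)) (hij : i ≠ j), ∃ x ∈ I, g = spGen i j hij x}

/-- The elementary symplectic group `ESp_{2n}(R)`. -/
def ESpAbs (n : ℕ) (R : Type*) [CommRing R] : Subgroup (SpecialLinearGroup (Fin (2 * n)) R) :=
  ESpGen n (⊤ : Ideal R)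

/-- The relative elementary symplectic group `ESp_{2n}(R, I)`: the normal closure of
`ESp_{2n}(I)` in `ESp_{2n}(R)`. -/
def ESpRel (n : ℕ) {R : Type*} [CommRing R] (I : Ideal R) :
    Subgroup (SpecialLinearGroup (Fin (2 * n)) R) :=
  normalClosureIn (ESpGen n I) (ESpAbs n R)

theorem ESpGen_le (n : ℕ) {R : Type*} [CommRing R] (I : Ideal R) :
    ESpGen n I ≤ EGen (2 * n) I := by
  refine (Subgroup.closure_le _).2 ?_
  rintro g ⟨i, j, hij, x, hx, rfl⟩
  by_cases h : i = sig j
  · refine Subgroup.subset_closure ⟨i, j, hij, x, hx, Subtype.ext ?_⟩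
    change seMat i j x = 1 + single i j x
    rw [seMat, if_pos h]
  · have hs : sig j ≠ sig i := fun e => hij (sig_injective e).symm
    have e : spGen i j hij x =
        SpecialLinearGroup.transvection hij x * SpecialLinearGroup.transvection hs
          (-((-1) ^ (i.val + j.val) * x)) :=
      Subtype.ext (seMat_of_ne i j h x)
    rw [e]
    exact mul_mem (Subgroup.subset_closure ⟨i, j, hij, x, hx, rfl⟩)
      (Subgroup.subset_closure ⟨_, _, hs, _, I.neg_mem (I.mul_mem_left _ hx), rfl⟩)

theorem normalClosureIn_mono {G : Type*} [Group G] {H H' K K' : Subgroup G}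
    (hH : H ≤ H') (hK : K ≤ K') : normalClosureIn H K ≤ normalClosureIn H' K' := by
  have h : Subgroup.normalClosure ((H.subgroupOf K : Subgroup K) : Set K) ≤
      (Subgroup.normalClosure ((H'.subgroupOf K' : Subgroup K') : Set K')).comap
        (Subgroup.inclusion hK) :=
    Subgroup.normalClosure_le_normal fun x hx =>
      Subgroup.subset_normalClosure (show (x : G) ∈ H' from hH hx)
  rintro g ⟨x, hx, rfl⟩
  exact ⟨Subgroup.inclusion hK x, h hx, rfl⟩

theorem ESpRel_le (n : ℕ) {R : Type*} [CommRing R] (I : Ideal R) :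
    ESpRel n I ≤ ERel (2 * n) I :=
  normalClosureIn_mono (ESpGen_le n I) (ESpGen_le n ⊤)

/-- Equivalence of rows in `Um_m(R, I)` under right multiplication by a subgroup `G` of
`SL_m(R)`: `v ∼ w` if `v = w g` for some `g ∈ G`. -/
def orbitSetoid {m : ℕ} {R : Type*} [CommRing R] (I : Ideal R)
    (G : Subgroup (SpecialLinearGroup (Fin m) R)) : Setoid (Um m I) where
  r v w := ∃ g ∈ G, (v : Fin m → R) = (w : Fin m → R) ᵥ* g.1
  iseqv := by
    refine ⟨fun v => ⟨1, one_mem _, (vecMul_one _).symm⟩, ?_, ?_⟩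
    · rintro v w ⟨g, hg, h⟩
      refine ⟨g⁻¹, inv_mem hg, ?_⟩
      have e : g.1 * (g⁻¹).1 = 1 := congrArg Subtype.val (mul_inv_cancel g)
      rw [h, vecMul_vecMul, e, vecMul_one]
    · rintro u v w ⟨g, hg, h⟩ ⟨k, hk, h'⟩
      refine ⟨k * g, mul_mem hk hg, ?_⟩
      have e : (k * g).1 = k.1 * g.1 := rfl
      rw [h, h', vecMul_vecMul, e]

/-- The orbit space `Um_m(R, I) / G`. -/
def UmOrbits {m : ℕ} {R : Type*} [CommRing R] (I : Ideal R)
    (G : Subgroup (SpecialLinearGroup (Fin m) R)) : Type _ :=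
  Quotient (orbitSetoid I G)

/-- The natural map `Um_{2n}(R, I) / ESp_{2n}(R, I) → Um_{2n}(R, I) / E_{2n}(R, I)`, sending the
class of a row to its class. -/
def naturalMap (n : ℕ) {R : Type*} [CommRing R] (I : Ideal R) :
    UmOrbits I (ESpRel n I) → UmOrbits I (ERel (2 * n) I) :=
  Quotient.map id fun _ _ ⟨g, hg, h⟩ => ⟨g, ESpRel_le n I hg, h⟩

end ElemOrbits

namespace ElemOrbits

open Matrix

/-! ### The standard alternating form, its transvections and shears. -/

section SymplecticForm

variable {n : ℕ} {R : Type*} [CommRing R]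

/-! Surjectivity is clear, as both quotients come from the same set of rows. For injectivity, both
groups are compared through moves `v ↦ v + x s` with `x ∈ I`, `v ⬝ᵥ w = 1` and `s ⬝ᵥ w = 0`. The
group `E_m(R, I)` acts by chains of moves when `m ≥ 3`: a generator `1 + x e_kj` is a composite of
two moves on each unimodular row (`transvection_mem_moveGroup`). Moves are compatible with
`SL_m(R)`, so the matrices acting by chains of moves form a normal subgroup. Conversely,
`ESp_{2n}(R, I)` realizes each move (`Move.exists_ESpRel`): pairing with `w` is `⟨·, u⟩` for some
`u`, and a shear followed by a transvection along `u` does the job. That these matrices lie in the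
relative group rests on `sympTransvection_mem`, where `n ≥ 2` leaves a spare hyperbolic pair. -/

theorem neg_one_pow_sig (i : Fin (2 * n)) : (-1 : R) ^ (sig i).val = -(-1) ^ i.val := by
  unfold sig
  split_ifs with h
  · simp [pow_succ]
  · obtain ⟨k, hk⟩ : ∃ k, i.val = k + 1 := ⟨i.val - 1, by omega⟩
    simp [hk, pow_succ]

theorem neg_one_pow_mul_self (k : ℕ) : (-1 : R) ^ k * (-1) ^ k = 1 := by
  rw [← mul_pow]; simp

/-- The vector representing pairing with `u` under the standard alternating form. -/
def skew (u : Fin (2 * n) → R) : Fin (2 * n) → R := fun i => (-1) ^ i.val * u (sig i)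

/-- The standard alternating form `⟨v, u⟩ = ∑ i, (-1) ^ i * v i * u (σ i)`. -/
def form (v u : Fin (2 * n) → R) : R := v ⬝ᵥ skew u

theorem skew_add (u s : Fin (2 * n) → R) : skew (u + s) = skew u + skew s := by
  ext i; simp [skew, mul_add]

theorem skew_smul (c : R) (u : Fin (2 * n) → R) : skew (c • u) = c • skew u := by
  ext i; simp [skew]; ring

theorem skew_neg (u : Fin (2 * n) → R) : skew (-u) = -skew u := by
  ext i; simp [skew]

theorem skew_skew (u : Fin (2 * n) → R) : skew (skew u) = -u := by
  ext i
  simp only [skew, neg_one_pow_sig, sig_sig, Pi.neg_apply]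
  linear_combination (-u i) * neg_one_pow_mul_self (R := R) i.val

theorem form_add_left (v w u : Fin (2 * n) → R) : form (v + w) u = form v u + form w u :=
  add_dotProduct _ _ _

theorem form_smul_left (c : R) (v u : Fin (2 * n) → R) : form (c • v) u = c * form v u :=
  smul_dotProduct _ _ _

theorem form_add_right (v u s : Fin (2 * n) → R) : form v (u + s) = form v u + form v s := by
  rw [form, skew_add, dotProduct_add]; rfl

theorem form_smul_right (c : R) (v u : Fin (2 * n) → R) : form v (c • u) = c * form v u := by
  rw [form, skew_smul, dotProduct_smul]; rfl

/-- The terms at `i` and `sig i` cancel, so no division by `2` is needed. -/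
theorem form_self (u : Fin (2 * n) → R) : form u u = 0 := by
  refine Finset.sum_involution (fun i _ => sig i) (fun i _ => ?_) (fun i _ _ => sig_ne i)
    (fun i _ => Finset.mem_univ _) (fun i _ => sig_sig i)
  simp only [skew, sig_sig, neg_one_pow_sig]
  ring

theorem form_swap (u v : Fin (2 * n) → R) : form u v = -form v u := by
  have h := form_self (u + v)
  rw [form_add_left, form_add_right, form_add_right, form_self, form_self] at h
  linear_combination h

theorem form_single_right (v : Fin (2 * n) → R) (j : Fin (2 * n)) :
    form v (Pi.single j 1) = (-1) ^ (sig j).val * v (sig j) := by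
  rw [form, dotProduct, Finset.sum_eq_single (sig j)]
  · simp [skew, sig_sig, mul_comm]
  · intro i _ hi
    have : sig i ≠ j := fun h => hi (by rw [← h, sig_sig])
    simp [skew, this]
  · simp

theorem form_single_left (v : Fin (2 * n) → R) (j : Fin (2 * n)) :
    form (Pi.single j 1) v = (-1) ^ j.val * v (sig j) := by
  rw [form_swap, form_single_right, neg_one_pow_sig]
  ring

/-- The symplectic transvection `v ↦ v + q ⟨v, u⟩ u`, as a matrix acting on rows. -/
def sympTransvection (u : Fin (2 * n) → R) (q : R) : Matrix (Fin (2 * n)) (Fin (2 * n)) R :=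
  1 + q • vecMulVec (skew u) u

/-- The map `v ↦ v + ⟨v, u⟩ s + ⟨v, s⟩ u`, as a matrix acting on rows. -/
def shear (u s : Fin (2 * n) → R) : Matrix (Fin (2 * n)) (Fin (2 * n)) R :=
  1 + (vecMulVec (skew u) s + vecMulVec (skew s) u)

theorem vecMul_sympTransvection (v u : Fin (2 * n) → R) (q : R) :
    v ᵥ* sympTransvection u q = v + (q * form v u) • u := by
  rw [sympTransvection, vecMul_add, vecMul_one, vecMul_smul, vecMul_vecMulVec, smul_smul]
  rfl

theorem vecMul_shear (v u s : Fin (2 * n) → R) :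
    v ᵥ* shear u s = v + (form v u • s + form v s • u) := by
  rw [shear, vecMul_add, vecMul_one, vecMul_add, vecMul_vecMulVec, vecMul_vecMulVec]
  rfl

theorem vecMul_matrix_single {m : ℕ} (v : Fin m → R) (i j : Fin m) (z : R) :
    v ᵥ* single i j z = (v i * z) • Pi.single j 1 := by
  ext k
  simp only [vecMul, dotProduct, single_apply, Pi.smul_apply, Pi.single_apply, smul_eq_mul]
  rw [Finset.sum_eq_single i (fun l _ hl => by simp [hl.symm]) (by simp)]
  by_cases h : k = j
  · simp [h]
  · simp [h, Ne.symm h]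

theorem shear_comm (u s : Fin (2 * n) → R) : shear u s = shear s u := by
  rw [shear, shear, add_comm (vecMulVec _ _)]

theorem shear_smul (c : R) (u s : Fin (2 * n) → R) : shear u (c • s) = shear (c • u) s := by
  refine ext_iff_vecMul.2 fun v => ?_
  simp only [vecMul_shear, form_smul_right]
  module

/-- A Heisenberg relation: shears along a fixed `u` are additive up to a transvection along `u`. It
breaks a shear into coordinate pieces. -/
theorem shear_mul_shear {u s t : Fin (2 * n) → R} (hs : form s u = 0) (ht : form t u = 0) :
    shear u s * shear u t = shear u (s + t) * sympTransvection u (form s t) := by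
  have ht' : form u t = 0 := by rw [form_swap, ht, neg_zero]
  refine ext_iff_vecMul.2 fun v => ?_
  simp only [← vecMul_vecMul, vecMul_shear, vecMul_sympTransvection, form_add_left,
    form_smul_left, form_add_right, hs, ht, ht', form_self]
  module

/-- Polarization of the quadratic map `u ↦ ⟨v, u⟩ u`; its cross term is the shear. -/
theorem sympTransvection_add {u s : Fin (2 * n) → R} (h : form u s = 0) (q : R) :
    sympTransvection (u + s) q =
      sympTransvection u q * sympTransvection s q * shear u (q • s) := by
  have h' : form s u = 0 := by rw [form_swap, h, neg_zero]
  refine ext_iff_vecMul.2 fun v => ?_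
  simp only [← vecMul_vecMul, vecMul_shear, vecMul_sympTransvection, form_add_left,
    form_smul_left, form_add_right, form_smul_right, h, h', form_self]
  module

theorem form_vecMul_shear {u s : Fin (2 * n) → R} (h : form u s = 0) (v w : Fin (2 * n) → R) :
    form (v ᵥ* shear u s) (w ᵥ* shear u s) = form v w := by
  simp only [vecMul_shear, form_add_left, form_smul_left, form_add_right, form_smul_right, h,
    form_swap s u, form_self, form_swap u w, form_swap s w]
  ring

/-- The shear is an isometry, so conjugation by it just moves the vector of the transvection. -/
theorem sympTransvection_mul_shear {u s : Fin (2 * n) → R} (h : form u s = 0)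
    (e : Fin (2 * n) → R) (q : R) :
    sympTransvection e q * shear u s = shear u s * sympTransvection (e ᵥ* shear u s) q := by
  refine ext_iff_vecMul.2 fun v => ?_
  rw [← vecMul_vecMul, ← vecMul_vecMul, vecMul_sympTransvection, vecMul_sympTransvection,
    form_vecMul_shear h, add_vecMul, smul_vecMul]

end SymplecticForm

/-! ### Transvections and shears in the elementary symplectic groups. -/

section ElementaryMembership

variable {n : ℕ} {R : Type*} [CommRing R]

/-- The matrices of the elements of a subgroup of `SL_m(R)`. -/
def matrices {m : ℕ} (G : Subgroup (SpecialLinearGroup (Fin m) R)) :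
    Set (Matrix (Fin m) (Fin m) R) :=
  {M | ∃ g ∈ G, g.1 = M}

theorem mul_mem_matrices {m : ℕ} {G : Subgroup (SpecialLinearGroup (Fin m) R)}
    {M N : Matrix (Fin m) (Fin m) R} (hM : M ∈ matrices G) (hN : N ∈ matrices G) :
    M * N ∈ matrices G := by
  obtain ⟨g, hg, rfl⟩ := hM
  obtain ⟨k, hk, rfl⟩ := hN
  exact ⟨g * k, mul_mem hg hk, rfl⟩

theorem mem_matrices_of_mul_left {m : ℕ} {G : Subgroup (SpecialLinearGroup (Fin m) R)}
    {M N : Matrix (Fin m) (Fin m) R} (hM : M ∈ matrices G) (h : M * N ∈ matrices G) :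
    N ∈ matrices G := by
  obtain ⟨g, hg, rfl⟩ := hM
  obtain ⟨k, hk, hk'⟩ := h
  refine ⟨g⁻¹ * k, mul_mem (inv_mem hg) hk, ?_⟩
  have e : (g⁻¹).1 * g.1 = 1 := congrArg Subtype.val (inv_mul_cancel g)
  change (g⁻¹).1 * k.1 = N
  rw [hk', ← mul_assoc, e, one_mul]

theorem mem_matrices_of_mul_right {m : ℕ} {G : Subgroup (SpecialLinearGroup (Fin m) R)}
    {M N : Matrix (Fin m) (Fin m) R} (hN : N ∈ matrices G) (h : M * N ∈ matrices G) :
    M ∈ matrices G := by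
  obtain ⟨g, hg, rfl⟩ := hN
  obtain ⟨k, hk, hk'⟩ := h
  refine ⟨k * g⁻¹, mul_mem hk (inv_mem hg), ?_⟩
  have e : g.1 * (g⁻¹).1 = 1 := congrArg Subtype.val (mul_inv_cancel g)
  change k.1 * (g⁻¹).1 = M
  rw [hk', mul_assoc, e, mul_one]

theorem matrices_mono {m : ℕ} {G H : Subgroup (SpecialLinearGroup (Fin m) R)} (h : G ≤ H) :
    matrices G ⊆ matrices H := fun _ ⟨g, hg, e⟩ => ⟨g, h hg, e⟩

theorem le_normalClosureIn {G : Type*} [Group G] {H K : Subgroup G} (h : H ≤ K) :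
    H ≤ normalClosureIn H K := fun x hx =>
  ⟨⟨x, h hx⟩, Subgroup.subset_normalClosure (show x ∈ H from hx), rfl⟩

theorem conj_mem_normalClosureIn {G : Type*} [Group G] {H K : Subgroup G} {g k : G}
    (hg : g ∈ normalClosureIn H K) (hk : k ∈ K) : k⁻¹ * g * k ∈ normalClosureIn H K := by
  obtain ⟨x, hx, rfl⟩ := hg
  refine ⟨(⟨k, hk⟩ : K)⁻¹ * x * ⟨k, hk⟩, ?_, rfl⟩
  simpa using Subgroup.normalClosure_normal.conj_mem x hx (⟨k, hk⟩ : K)⁻¹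

theorem ESpGen_mono {I J : Ideal R} (h : I ≤ J) : ESpGen n I ≤ ESpGen n J := by
  refine Subgroup.closure_mono ?_
  rintro g ⟨i, j, hij, x, hx, rfl⟩
  exact ⟨i, j, hij, x, h hx, rfl⟩

theorem ESpGen_le_ESpRel (I : Ideal R) : ESpGen n I ≤ ESpRel n I :=
  le_normalClosureIn (ESpGen_mono le_top)

theorem mem_ESpRel_of_mul_eq {I : Ideal R} {M N A : Matrix (Fin (2 * n)) (Fin (2 * n)) R}
    (hM : M ∈ matrices (ESpRel n I)) (hA : A ∈ matrices (ESpAbs n R)) (h : M * A = A * N) :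
    N ∈ matrices (ESpRel n I) := by
  obtain ⟨g, hg, rfl⟩ := hM
  obtain ⟨k, hk, rfl⟩ := hA
  refine ⟨k⁻¹ * g * k, conj_mem_normalClosureIn hg hk, ?_⟩
  have e : (k⁻¹).1 * k.1 = 1 := congrArg Subtype.val (inv_mul_cancel k)
  change (k⁻¹).1 * g.1 * k.1 = N
  rw [mul_assoc, h, ← mul_assoc, e, one_mul]

theorem seMat_mem {J : Ideal R} {i j : Fin (2 * n)} (hij : i ≠ j) {z : R} (hz : z ∈ J) :
    seMat i j z ∈ matrices (ESpGen n J) :=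
  ⟨spGen i j hij z, Subgroup.subset_closure ⟨i, j, hij, z, hz, rfl⟩, rfl⟩

theorem sympTransvection_single_mem {J : Ideal R} (j : Fin (2 * n)) {q : R} (hq : q ∈ J) :
    sympTransvection (Pi.single j 1) q ∈ matrices (ESpGen n J) := by
  have e : sympTransvection (Pi.single j 1) q = seMat (sig j) j ((-1) ^ (sig j).val * q) := by
    refine ext_iff_vecMul.2 fun v => ?_
    rw [seMat, if_pos rfl, vecMul_sympTransvection, vecMul_add, vecMul_one, vecMul_matrix_single,
      form_single_right]
    module
  rw [e]
  exact seMat_mem (sig_ne j) (J.mul_mem_left _ hq)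

theorem shear_single_single_mem {J : Ideal R} {j k : Fin (2 * n)} (hkj : k ≠ j) (hk : k ≠ sig j)
    {y : R} (hy : y ∈ J) :
    shear (Pi.single j 1) (y • Pi.single k 1) ∈ matrices (ESpGen n J) := by
  have e : shear (Pi.single j 1) (y • Pi.single k 1) =
      seMat (sig k) j ((-1) ^ (sig k).val * y) := by
    refine ext_iff_vecMul.2 fun v => ?_
    rw [seMat, if_neg fun h => hkj (sig_injective h), vecMul_shear, vecMul_sub, vecMul_add,
      vecMul_one, vecMul_matrix_single, vecMul_matrix_single, form_smul_right, form_single_right,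
      form_single_right, sig_sig, pow_add, neg_one_pow_sig, neg_one_pow_sig]
    have h : (-1 : R) ^ k.val * (-1) ^ j.val * ((-1) ^ k.val * y) = (-1) ^ j.val * y := by
      linear_combination ((-1) ^ j.val * y) * neg_one_pow_mul_self (R := R) k.val
    have h' : v (sig j) * (-((-1 : R) ^ k.val) * (-1) ^ j.val * (-(-1) ^ k.val * y)) =
        v (sig j) * ((-1) ^ j.val * y) := by
      rw [← h]; ring
    rw [h']
    module
  rw [e]
  exact seMat_mem (fun h => hk (by rw [← h, sig_sig])) (J.mul_mem_left _ hy)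

theorem form_mem {J : Ideal R} {s : Fin (2 * n) → R} (hs : ∀ i, s i ∈ J) (t : Fin (2 * n) → R) :
    form s t ∈ J := by
  unfold form dotProduct
  exact Ideal.sum_mem J fun i _ => J.mul_mem_right (skew t i) (hs i)

theorem form_single_of_zero {j : Fin (2 * n)} {s : Fin (2 * n) → R} (h : s (sig j) = 0) :
    form s (Pi.single j 1) = 0 := by
  rw [form_single_right, h, mul_zero]

/-- Shears between basis vectors are generators. Adding up the coordinates of `s` costs only
transvections along `e_j` with parameter in `J`, which are generators too. -/
theorem shear_single_mem {J : Ideal R} (j : Fin (2 * n)) {s : Fin (2 * n) → R}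
    (hs : ∀ i, s i ∈ J) (h0 : s j = 0) (h1 : s (sig j) = 0) :
    shear (Pi.single j 1) s ∈ matrices (ESpGen n J) := by
  have key : ∀ S : Finset (Fin (2 * n)), shear (Pi.single j 1)
      (∑ k ∈ S, s k • (Pi.single k 1 : Fin (2 * n) → R)) ∈ matrices (ESpGen n J) := by
    intro S
    induction S using Finset.induction_on with
    | empty =>
      refine ⟨1, one_mem _, ext_iff_vecMul.2 fun v => ?_⟩
      have h : form v (0 : Fin (2 * n) → R) = 0 := by simp [form, skew, dotProduct]
      change v ᵥ* (1 : Matrix (Fin (2 * n)) (Fin (2 * n)) R) = _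
      rw [Finset.sum_empty, vecMul_shear, vecMul_one, h]
      simp
    | insert k S hk ih =>
      rw [Finset.sum_insert hk]
      by_cases hkj : k = j
      · simpa [hkj, h0] using ih
      by_cases hkj' : k = sig j
      · simpa [hkj', h1] using ih
      have hf : form (s k • (Pi.single k 1 : Fin (2 * n) → R)) (Pi.single j 1) = 0 := by
        refine form_single_of_zero ?_
        simp [Ne.symm hkj']
      have hg : form (∑ l ∈ S, s l • (Pi.single l 1 : Fin (2 * n) → R)) (Pi.single j 1) = 0 := by
        refine form_single_of_zero ?_
        simp [Pi.single_apply, h1]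
      refine mem_matrices_of_mul_right (sympTransvection_single_mem (J := J) j (form_mem ?_ _))
        (shear_mul_shear hf hg ▸ mul_mem_matrices (shear_single_single_mem hkj hkj' (hs k)) ih)
      intro i
      exact J.mul_mem_right _ (hs k)
  convert key Finset.univ using 2
  exact pi_eq_sum_univ' s

variable {I : Ideal R}

/-- This transvection is a conjugate of the one along `e_i`. The conjugating shear is only in the
absolute group, as `s` need not have entries in `I`. -/
theorem sympTransvection_single_add_mem (i : Fin (2 * n)) {s : Fin (2 * n) → R}
    (h0 : s i = 0) (h1 : s (sig i) = 0) {q : R} (hq : q ∈ I) :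
    sympTransvection (Pi.single i 1 + s) q ∈ matrices (ESpRel n I) := by
  have hA : shear (Pi.single (sig i) 1) ((-1 : R) ^ i.val • s) ∈ matrices (ESpAbs n R) :=
    shear_single_mem (J := ⊤) _ (fun _ => Submodule.mem_top) (by simp [h1])
      (by simp [sig_sig, h0])
  have hf : form (Pi.single (sig i) 1) ((-1 : R) ^ i.val • s) = 0 := by
    rw [form_single_left, sig_sig]; simp [h0]
  have he : (Pi.single i 1 : Fin (2 * n) → R) ᵥ*
      shear (Pi.single (sig i) 1) ((-1 : R) ^ i.val • s) = Pi.single i 1 + s := by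
    rw [vecMul_shear, form_single_left, form_single_left]
    simp [h1, smul_smul, neg_one_pow_mul_self]
  have h := sympTransvection_mul_shear hf (Pi.single i 1) q
  rw [he] at h
  exact mem_ESpRel_of_mul_eq
    (matrices_mono (ESpGen_le_ESpRel I) (sympTransvection_single_mem i hq)) hA h

theorem shear_single_smul_mem (i : Fin (2 * n)) {u : Fin (2 * n) → R}
    (h0 : u i = 0) (h1 : u (sig i) = 0) {q : R} (hq : q ∈ I) :
    shear (Pi.single i 1) (q • u) ∈ matrices (ESpRel n I) :=
  matrices_mono (ESpGen_le_ESpRel I) (shear_single_mem i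
    (fun k => I.mul_mem_right _ hq) (by simp [h0]) (by simp [h1]))

/-- In the polarization of the transvection along `e_i + u`, all other factors are already known to
be in the group. -/
theorem sympTransvection_mem_of_zero (i : Fin (2 * n)) {u : Fin (2 * n) → R}
    (h0 : u i = 0) (h1 : u (sig i) = 0) {q : R} (hq : q ∈ I) :
    sympTransvection u q ∈ matrices (ESpRel n I) := by
  have h : form (Pi.single i 1) u = 0 := by rw [form_single_left, h1, mul_zero]
  have key := sympTransvection_single_add_mem i h0 h1 hq
  rw [sympTransvection_add h] at key
  exact mem_matrices_of_mul_left
    (matrices_mono (ESpGen_le_ESpRel I) (sympTransvection_single_mem i hq))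
    (mem_matrices_of_mul_right (shear_single_smul_mem i h0 h1 hq) key)

/-- For `n ≥ 2`, all symplectic transvections with parameter in `I` lie in `ESp_{2n}(R, I)`. -/
theorem sympTransvection_mem (hn : 2 ≤ n) (u : Fin (2 * n) → R) {q : R} (hq : q ∈ I) :
    sympTransvection u q ∈ matrices (ESpRel n I) := by
  obtain ⟨i, k, hki, hki'⟩ : ∃ i k : Fin (2 * n), k ≠ i ∧ k ≠ sig i :=
    ⟨⟨0, by omega⟩, ⟨2, by omega⟩, by simp, by simp [sig]⟩
  have hk1 : sig k ≠ i := fun h => hki' (by rw [← h, sig_sig])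
  have hk2 : sig k ≠ sig i := fun h => hki (sig_injective h)
  -- The part `a` of `u` on the pair of `i` vanishes on the pair of `k`, and the rest `b` vanishes
  -- on the pair of `i`.
  set a : Fin (2 * n) → R := u i • Pi.single i 1 + u (sig i) • Pi.single (sig i) 1 with ha
  set b : Fin (2 * n) → R := u - a with hb
  have ak : a k = 0 := by simp [ha, hki, hki']
  have ak' : a (sig k) = 0 := by simp [ha, hk1, hk2]
  have bi : b i = 0 := by simp [hb, ha, (sig_ne i).symm]
  have bi' : b (sig i) = 0 := by simp [hb, ha, sig_ne i]
  have f1 : form b (Pi.single i 1) = 0 := form_single_of_zero bi'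
  have f2 : form b (Pi.single (sig i) 1) = 0 := form_single_of_zero (by rw [sig_sig, bi])
  have hab : form a b = 0 := by
    rw [form_swap, ha, form_add_right, form_smul_right, form_smul_right, f1, f2]; simp
  have hu : u = a + b := by rw [hb]; abel
  rw [hu, sympTransvection_add hab]
  refine mul_mem_matrices (mul_mem_matrices (sympTransvection_mem_of_zero k ak ak' hq)
    (sympTransvection_mem_of_zero i bi bi' hq)) ?_
  -- The cross term is split along `e_i` and `e_{σ(i)}`, both orthogonal to `b`.
  have e : shear a (q • b) = shear b
      ((q * u i) • Pi.single i 1 + (q * u (sig i)) • Pi.single (sig i) 1) := by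
    rw [shear_comm, ← shear_smul, ha, smul_add, smul_smul, smul_smul]
  have g1 : shear b ((q * u i) • Pi.single i 1) ∈ matrices (ESpRel n I) := by
    rw [shear_smul, shear_comm]
    exact shear_single_smul_mem i bi bi' (I.mul_mem_right _ hq)
  have g2 : shear b ((q * u (sig i)) • Pi.single (sig i) 1) ∈ matrices (ESpRel n I) := by
    rw [shear_smul, shear_comm]
    exact shear_single_smul_mem (sig i) bi' (by rw [sig_sig, bi]) (I.mul_mem_right _ hq)
  rw [e]
  have hf : form ((q * u i) • (Pi.single i 1 : Fin (2 * n) → R)) b = 0 := by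
    rw [form_smul_left, form_swap, f1]; simp
  have hg : form ((q * u (sig i)) • (Pi.single (sig i) 1 : Fin (2 * n) → R)) b = 0 := by
    rw [form_smul_left, form_swap, f2]; simp
  refine mem_matrices_of_mul_right (sympTransvection_mem_of_zero i bi bi' (form_mem ?_ _))
    (shear_mul_shear hf hg ▸ mul_mem_matrices g1 g2)
  intro l
  exact I.mul_mem_right _ (I.mul_mem_right _ hq)

theorem shear_smul_mem (hn : 2 ≤ n) {u s : Fin (2 * n) → R} (h : form u s = 0) {x : R}
    (hx : x ∈ I) : shear u (x • s) ∈ matrices (ESpRel n I) := by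
  have key := sympTransvection_mem hn (u + s) hx
  rw [sympTransvection_add h] at key
  exact mem_matrices_of_mul_left (mul_mem_matrices (sympTransvection_mem hn u hx)
    (sympTransvection_mem hn s hx)) key

end ElementaryMembership

/-! ### Moves of unimodular rows, and the two groups acting through them. -/

section Moves

variable {R : Type*} [CommRing R]

/-- `v'` arises from the row `v` by adding `x s`, where `x ∈ I` and `s` is annihilated by a column
`w` with `v w = 1`. -/
def Move {m : ℕ} (I : Ideal R) (v v' : Fin m → R) : Prop :=
  ∃ (w s : Fin m → R) (x : R), x ∈ I ∧ v ⬝ᵥ w = 1 ∧ s ⬝ᵥ w = 0 ∧ v' = v + x • s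

theorem Move.exists_ESpRel {n : ℕ} (hn : 2 ≤ n) {I : Ideal R} {v v' : Fin (2 * n) → R}
    (h : Move I v v') : ∃ g ∈ ESpRel n I, v' = v ᵥ* g.1 := by
  obtain ⟨w, s, x, hx, hv, hs, rfl⟩ := h
  -- Nondegeneracy: this `u` represents the functional `t ↦ t ⬝ᵥ w`.
  set u := -skew w with hu
  have hf : ∀ t, form t u = t ⬝ᵥ w := fun t => by
    rw [form, hu, skew_neg, skew_skew, neg_neg]
  have hvu : form v u = 1 := by rw [hf, hv]
  have hsu : form s u = 0 := by rw [hf, hs]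
  -- The shear sends `v` to `v + x s + x ⟨v, s⟩ u`; the transvection removes the last term, since
  -- this row pairs to `1` with `u`.
  obtain ⟨g, hg, e⟩ := mul_mem_matrices
    (shear_smul_mem hn (by rw [form_swap, hsu, neg_zero]) hx)
    (sympTransvection_mem hn u (I.neg_mem (I.mul_mem_right (form v s) hx)))
  refine ⟨g, hg, ?_⟩
  rw [e, ← vecMul_vecMul, vecMul_shear, vecMul_sympTransvection, form_add_left, form_add_left,
    form_smul_left, form_smul_left, form_smul_left, form_smul_right, hvu, hsu, form_self]
  module

theorem exists_ESpRel_of_eqvGen {n : ℕ} (hn : 2 ≤ n) {I : Ideal R} {v v' : Fin (2 * n) → R}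
    (h : Relation.EqvGen (Move I) v v') : ∃ g ∈ ESpRel n I, v' = v ᵥ* g.1 := by
  induction h with
  | rel v v' h => exact h.exists_ESpRel hn
  | refl v => exact ⟨1, one_mem _, (vecMul_one v).symm⟩
  | symm v v' _ ih =>
    obtain ⟨g, hg, rfl⟩ := ih
    refine ⟨g⁻¹, inv_mem hg, ?_⟩
    have e : g.1 * (g⁻¹).1 = 1 := congrArg Subtype.val (mul_inv_cancel g)
    rw [vecMul_vecMul, e, vecMul_one]
  | trans u v w _ _ ih₁ ih₂ =>
    obtain ⟨g, hg, rfl⟩ := ih₁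
    obtain ⟨k, hk, rfl⟩ := ih₂
    exact ⟨g * k, mul_mem hg hk, vecMul_vecMul _ _ _⟩

theorem dotProduct_vecMul_mulVec_inv {m : ℕ} (g : SpecialLinearGroup (Fin m) R)
    (v w : Fin m → R) : (v ᵥ* g.1) ⬝ᵥ ((g⁻¹).1 *ᵥ w) = v ⬝ᵥ w := by
  have e : g.1 * (g⁻¹).1 = 1 := congrArg Subtype.val (mul_inv_cancel g)
  rw [dotProduct_mulVec, vecMul_vecMul, e, vecMul_one]

/-- Replacing `w` by `g⁻¹ w` preserves all the pairings in a move. -/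
theorem eqvGen_move_vecMul {m : ℕ} {I : Ideal R} {v v' : Fin m → R}
    (h : Relation.EqvGen (Move I) v v') (g : SpecialLinearGroup (Fin m) R) :
    Relation.EqvGen (Move I) (v ᵥ* g.1) (v' ᵥ* g.1) := by
  induction h with
  | rel v v' h =>
    obtain ⟨w, s, x, hx, hv, hs, rfl⟩ := h
    refine .rel _ _ ⟨(g⁻¹).1 *ᵥ w, s ᵥ* g.1, x, hx, ?_, ?_, ?_⟩
    · rw [dotProduct_vecMul_mulVec_inv, hv]
    · rw [dotProduct_vecMul_mulVec_inv, hs]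
    · rw [add_vecMul, smul_vecMul]
  | refl v => exact .refl _
  | symm v v' _ ih => exact .symm _ _ ih
  | trans u v w _ _ ih₁ ih₂ => exact .trans _ _ _ ih₁ ih₂

theorem exists_dual_vecMul {m : ℕ} {v : Fin m → R} (h : ∃ w, v ⬝ᵥ w = 1)
    (g : SpecialLinearGroup (Fin m) R) : ∃ w, (v ᵥ* g.1) ⬝ᵥ w = 1 := by
  obtain ⟨w, hw⟩ := h
  exact ⟨(g⁻¹).1 *ᵥ w, by rw [dotProduct_vecMul_mulVec_inv, hw]⟩

/-- The matrices that send each unimodular row to a row reachable from it by moves. -/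
def moveGroup (m : ℕ) (I : Ideal R) : Subgroup (SpecialLinearGroup (Fin m) R) where
  carrier := {g | ∀ v : Fin m → R, (∃ w, v ⬝ᵥ w = 1) →
    Relation.EqvGen (Move I) v (v ᵥ* g.1)}
  one_mem' v _ := by
    change Relation.EqvGen (Move I) v (v ᵥ* (1 : Matrix (Fin m) (Fin m) R))
    rw [vecMul_one]
    exact .refl _
  mul_mem' {a b} ha hb v hv := by
    change Relation.EqvGen (Move I) v (v ᵥ* (a.1 * b.1))
    rw [← vecMul_vecMul]
    exact .trans _ _ _ (ha v hv) (hb _ (exists_dual_vecMul hv a))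
  inv_mem' {a} ha v hv := by
    have h := ha _ (exists_dual_vecMul hv a⁻¹)
    have e : (a⁻¹).1 * a.1 = 1 := congrArg Subtype.val (inv_mul_cancel a)
    rw [vecMul_vecMul, e, vecMul_one] at h
    exact .symm _ _ h

instance moveGroup_normal (m : ℕ) (I : Ideal R) : (moveGroup m I).Normal where
  conj_mem a ha g v hv := by
    have h := eqvGen_move_vecMul (ha _ (exists_dual_vecMul hv g)) g⁻¹
    have e : g.1 * (g⁻¹).1 = 1 := congrArg Subtype.val (mul_inv_cancel g)
    rw [vecMul_vecMul v, e, vecMul_one, vecMul_vecMul, vecMul_vecMul, ← mul_assoc] at h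
    exact h

/-- With a third index `l`, two moves in the `j`, `l` plane use columns differing by `-v k` at `l`
and agreeing at `j`. Their `e_l` terms cancel and `x v_k e_j` remains. -/
theorem transvection_mem_moveGroup {m : ℕ} (hm : 3 ≤ m) {I : Ideal R} {k j : Fin m} (hkj : k ≠ j)
    {x : R} (hx : x ∈ I) : SpecialLinearGroup.transvection hkj x ∈ moveGroup m I := by
  rintro v ⟨w, hw⟩
  obtain ⟨l, hlk, hlj⟩ : ∃ l : Fin m, l ≠ k ∧ l ≠ j := by
    obtain ⟨l, hl⟩ := Finset.exists_mem_notMem_of_card_lt_card (s := {k, j}) (t := Finset.univ)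
      (lt_of_le_of_lt Finset.card_le_two (by simpa using Nat.lt_of_succ_le hm))
    exact ⟨l, by simpa using hl⟩
  set v' : Fin m → R := v + x • (w l • Pi.single j 1 - w j • Pi.single l 1) with hv'
  -- The correction is a Koszul column killed by `v'`, so `w'` is again dual to `v'`.
  set w' : Fin m → R := w + (v' l • Pi.single k 1 - v' k • Pi.single l 1) with hw'
  have h1 : v' ⬝ᵥ w = 1 := by
    rw [hv', add_dotProduct, smul_dotProduct, sub_dotProduct, smul_dotProduct, smul_dotProduct,
      single_one_dotProduct, single_one_dotProduct, hw]
    simp [mul_comm]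
  have h2 : v' ⬝ᵥ w' = 1 := by
    rw [hw', dotProduct_add, dotProduct_sub, dotProduct_smul, dotProduct_smul,
      dotProduct_single_one, dotProduct_single_one, h1]
    simp [mul_comm]
  have hvk : v' k = v k := by simp [hv', hkj, hlk.symm]
  have hwl : w' l = w l - v k := by simp [hw', hlk, hvk, sub_eq_add_neg]
  have hwj : w' j = w j := by simp [hw', hkj.symm, hlj.symm]
  refine .trans _ v' _ (.rel _ _ ⟨w, _, x, hx, hw, ?_, hv'⟩) (.rel _ _
    ⟨w', w' j • Pi.single l 1 - w' l • Pi.single j 1, x, hx, h2, ?_, ?_⟩)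
  · simp [sub_dotProduct, mul_comm]
  · simp [sub_dotProduct, mul_comm]
  · have e : (SpecialLinearGroup.transvection hkj x).1 = 1 + single k j x := rfl
    rw [e, vecMul_add, vecMul_one, vecMul_matrix_single, hwl, hwj, hv']
    module

/-- Since `moveGroup` is normal, checking the generators with parameter in `I` suffices. -/
theorem ERel_le_moveGroup {m : ℕ} (hm : 3 ≤ m) (I : Ideal R) : ERel m I ≤ moveGroup m I := by
  have h : EGen m I ≤ moveGroup m I := by
    refine (Subgroup.closure_le _).2 ?_
    rintro g ⟨i, j, hij, x, hx, rfl⟩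
    exact transvection_mem_moveGroup hm hij hx
  have h' : Subgroup.normalClosure (((EGen m I).subgroupOf (EAbs m R) : Subgroup (EAbs m R)) :
      Set (EAbs m R)) ≤ (moveGroup m I).subgroupOf (EAbs m R) :=
    Subgroup.normalClosure_le_normal fun g hg => h hg
  rintro g ⟨a, ha, rfl⟩
  exact h' ha

end Moves

end ElemOrbits

set_option linter.unusedVariables false in
/-- If `2` is invertible in the commutative ring `R`, then for every ideal `I` and all `n ≥ 2` the
natural map `Um_{2n}(R, I) / ESp_{2n}(R, I) → Um_{2n}(R, I) / E_{2n}(R, I)` is bijective. -/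
theorem mainTheorem6 {R : Type*} [CommRing R] (h2 : IsUnit (2 : R)) (I : Ideal R) (n : ℕ)
    (hn : 2 ≤ n) : Function.Bijective (ElemOrbits.naturalMap n I) := by
  constructor
  · intro a b
    induction a using Quotient.inductionOn with | _ v
    induction b using Quotient.inductionOn with | _ w
    intro h
    obtain ⟨g, hg, e⟩ : ∃ g ∈ ElemOrbits.ERel (2 * n) I,
        (v : Fin (2 * n) → R) = Matrix.vecMul (w : Fin (2 * n) → R) g.1 := Quotient.exact h
    have hm := ElemOrbits.ERel_le_moveGroup (by omega) I hg _ w.2.1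
    obtain ⟨k, hk, e'⟩ := ElemOrbits.exists_ESpRel_of_eqvGen hn hm
    exact Quotient.sound ⟨k, hk, e.trans e'⟩
  · intro b
    induction b using Quotient.inductionOn with | _ w
    exact ⟨Quotient.mk _ w, rfl⟩
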